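/- Let $R$ be a commutative noetherian ring (with unit), let $X=\operatorname{Spec}(R)$, and let $\dim(R)$ denote its Krull dimension (with $\dim(0)=-\infty$). (i) If every open subset of $X$, regarded as an open subscheme, is an affine scheme, then $\dim(R)\leq 1$. (ii) Conversely, suppose that $\dim(R)\leq 1$ and, in case $\dim(R)=1$, suppose moreover that $R$ is reduced. Then every open subset of $X$, regarded as an open subscheme, is an affine scheme. -/

import Mathlib

universe u

/-!
If `dim R ≤ 1`, every closed set `V(I)` is a hypersurface up to finitely many closed points: choose
`f ∈ I` outside the minimal primes not containing `I`; a prime `p` containing `f` but not `I` is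
then minimal over `(f)` and maximal, so there are finitely many of them. Write `1 = a + b` with
`a ∈ I` and `b` in all these maximal ideals. On the complement `U` of `V(I)` the sections `a`, `b`
generate the unit ideal, and `U ∩ D(a) = D(a)`, `U ∩ D(b) = D(b * f)` are affine, whence `U` is.

Conversely, the property that all open subsets are affine passes to quotients and localizations
of `R`. If `dim R ≥ 2` this gives a two-dimensional Noetherian local domain `S` whose punctured
spectrum `U = D(x) ∪ D(y)` is affine, for a system of parameters `x`, `y`. Hence
`1 = x * a + y * b` with sections `a`, `b` over `U`, whose denominators are cleared both by `x ^ N`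
and by `y ^ N`. Expanding `(x * a + y * b) ^ (2 * k)` shows, for `s = 2 * N` and every `k`, that
`(x ^ k) ^ s * (y ^ k) ^ s` lies in `((x ^ k) ^ (s + 1), (y ^ k) ^ (s + 1))`
(`pow_mul_pow_mem_span_of_mul_add_mul_eq_one`). With `ℓ k` the length of `S ⧸ (x ^ k, y ^ k)`, a
count of monomials then gives `ℓ ((s + 1) * k) ≤ ((s + 1) ^ 2 - 1) * ℓ k`
(`Ideal.colength_span_pow_le_of_mul_mem`). Iterating this contradicts the bound `k ^ 2 ≤ ℓ k`
(`Ideal.sq_le_colength_span_pow`), because `s` does not depend on `k`.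
-/

/-! ### Lengths of quotients by ideals generated by powers -/

/-- The length of `R ⧸ I` as an `R`-module. -/
noncomputable abbrev Ideal.colength {R : Type*} [CommRing R] (I : Ideal R) : ℕ∞ :=
  Module.length R (R ⧸ I)

namespace Ideal

section Colength

variable {R : Type*} [CommRing R]

lemma colength_anti {I J : Ideal R} (h : I ≤ J) : J.colength ≤ I.colength := by
  simpa only [colength, Module.length_quotient] using Order.coheight_anti h

lemma colength_add_one_le {I J : Ideal R} (h : I < J) : J.colength + 1 ≤ I.colength := by
  simpa only [colength, Module.length_quotient] using Order.coheight_add_one_le h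

lemma colength_top : (⊤ : Ideal R).colength = 0 :=
  Module.length_eq_zero_iff.mpr (Submodule.Quotient.subsingleton_iff.mpr rfl)

/-- Additivity of length along `0 → R ⧸ (J : a) → R ⧸ J → R ⧸ (J + (a)) → 0`. -/
lemma colength_eq_add {J K : Ideal R} {a : R} (hK : ∀ r, r ∈ K ↔ a * r ∈ J) :
    J.colength = K.colength + (J ⊔ span {a}).colength := by
  have hle : K ≤ Submodule.comap (LinearMap.mulLeft R a) J := fun r hr => (hK r).1 hr
  refine Module.length_eq_add_of_exact
    (Submodule.mapQ K J (LinearMap.mulLeft R a) hle)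
    (Submodule.factor (le_sup_left : J ≤ J ⊔ span {a})) ?_ (Submodule.factor_surjective _) ?_
  · rw [← LinearMap.ker_eq_bot, LinearMap.ker_eq_bot']
    intro m hm
    obtain ⟨r, rfl⟩ := Submodule.Quotient.mk_surjective _ m
    rw [Submodule.mapQ_apply, Submodule.Quotient.mk_eq_zero] at hm
    rw [Submodule.Quotient.mk_eq_zero]
    exact (hK r).2 hm
  · intro m
    obtain ⟨r, rfl⟩ := Submodule.Quotient.mk_surjective _ m
    constructor
    · intro h
      have h' : r ∈ J ⊔ span {a} := by
        rw [← Submodule.Quotient.mk_eq_zero (J ⊔ span {a})]; exact h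
      obtain ⟨j, hj, z, hz, rfl⟩ := Submodule.mem_sup.1 h'
      obtain ⟨c, rfl⟩ := mem_span_singleton'.1 hz
      refine ⟨Submodule.Quotient.mk c, ?_⟩
      rw [Submodule.mapQ_apply, Submodule.Quotient.eq]
      have : (LinearMap.mulLeft R a) c - (j + c * a) = -j := by
        simp only [LinearMap.mulLeft_apply]; ring
      rw [this]
      exact J.neg_mem hj
    · rintro ⟨n, hn⟩
      obtain ⟨c, rfl⟩ := Submodule.Quotient.mk_surjective _ n
      rw [← hn, Submodule.mapQ_apply]
      change (Submodule.Quotient.mk (a * c) : R ⧸ (J ⊔ span {a})) = 0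
      rw [Submodule.Quotient.mk_eq_zero]
      exact mem_sup_right (mem_span_singleton'.2 ⟨c, mul_comm _ _⟩)

lemma colength_le_add {J K : Ideal R} {a : R} (hK : ∀ r ∈ K, a * r ∈ J) :
    J.colength ≤ K.colength + (J ⊔ span {a}).colength := by
  rw [colength_eq_add (J := J) (K := Submodule.comap (LinearMap.mulLeft R a) J) (a := a)
    fun _ => Iff.rfl]
  gcongr
  exact colength_anti hK

lemma mul_mem_of_mem_span_pair {J : Ideal R} {a p q : R} (hp : a * p ∈ J) (hq : a * q ∈ J) :
    ∀ r ∈ span {p, q}, a * r ∈ J := by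
  intro r hr
  obtain ⟨c, d, rfl⟩ := mem_span_pair.1 hr
  have : a * (c * p + d * q) = c * (a * p) + d * (a * q) := by ring
  rw [this]
  exact J.add_mem (J.mul_mem_left _ hp) (J.mul_mem_left _ hq)

lemma colength_span_pow_left_le (u z : R) (i : ℕ) :
    (span {u ^ i, z}).colength ≤ i * (span {u, z}).colength := by
  induction i with
  | zero =>
    have : span {u ^ 0, z} = ⊤ := by
      rw [eq_top_iff_one]; exact subset_span (by simp)
    rw [this, colength_top]; simp
  | succ i ih =>
    have h1 : span {u, z} ≤ span {u ^ (i + 1), z} ⊔ span {u} := by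
      rw [span_le]
      rintro _ (rfl | rfl)
      · exact mem_sup_right (subset_span rfl)
      · exact mem_sup_left (subset_span (by simp))
    calc _ ≤ (span {u ^ i, z}).colength + (span {u ^ (i + 1), z} ⊔ span {u}).colength := by
          refine colength_le_add (mul_mem_of_mem_span_pair ?_ ?_)
          · exact subset_span (by simp [pow_succ'])
          · exact mul_mem_left _ _ (subset_span (by simp))
      _ ≤ i * (span {u, z}).colength + (span {u, z}).colength := by
          gcongr
          exact colength_anti h1
      _ = _ := by push_cast; ring

lemma colength_span_pow_pow_le (u v : R) (i j : ℕ) :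
    (span {u ^ i, v ^ j}).colength ≤ i * j * (span {u, v}).colength := by
  refine (colength_span_pow_left_le u (v ^ j) i).trans ?_
  rw [mul_assoc]
  gcongr
  rw [span_pair_comm, span_pair_comm (x := u)]
  exact colength_span_pow_left_le v u j

/-- Of the `(s + 1) ^ 2` monomials `u ^ i * v ^ j` with `i, j ≤ s`, which generate the successive
quotients of `R ⧸ (u ^ (s + 1), v ^ (s + 1))` over `R ⧸ (u, v)`, the relation makes the last
one superfluous. -/
lemma colength_span_pow_le_of_mul_mem {u v : R} {s : ℕ}
    (h : u ^ s * v ^ s ∈ span {u ^ (s + 1), v ^ (s + 1)}) :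
    (span {u ^ (s + 1), v ^ (s + 1)}).colength ≤
      (s * (s + 2) : ℕ) * (span {u, v}).colength := by
  have h1 : span {u ^ s, v ^ (s + 1)} ≤ span {u ^ (s + 1), v ^ (s + 1)} ⊔ span {u ^ s} := by
    rw [span_le]
    rintro _ (rfl | rfl)
    · exact mem_sup_right (subset_span rfl)
    · exact mem_sup_left (subset_span (by simp))
  calc _ ≤ (span {u ^ 1, v ^ s}).colength
        + (span {u ^ (s + 1), v ^ (s + 1)} ⊔ span {u ^ s}).colength := by
        refine colength_le_add (mul_mem_of_mem_span_pair ?_ h)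
        exact subset_span (by simp [pow_succ])
    _ ≤ (1 : ℕ) * s * (span {u, v}).colength
        + s * (s + 1 : ℕ) * (span {u, v}).colength := by
        gcongr
        · exact colength_span_pow_pow_le u v 1 s
        · exact (colength_anti h1).trans (colength_span_pow_pow_le u v s (s + 1))
    _ = _ := by push_cast; ring

end Colength

/-! ### A quadratic lower bound -/

section LowerBound

variable {R : Type*} [CommRing R]

/-- The preimage in `R` of the ideal generated by `x ^ i` in the localization at the prime `p`. -/
def localPow (p : Ideal R) [p.IsPrime] (x : R) (i : ℕ) : Ideal R where
  carrier := {r | ∃ t, t ∉ p ∧ x ^ i ∣ t * r}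
  zero_mem' := ⟨1, p.one_notMem, by simp⟩
  add_mem' := by
    rintro r r' ⟨t, ht, h⟩ ⟨t', ht', h'⟩
    refine ⟨t * t', fun hm => (IsPrime.mem_or_mem ‹_› hm).elim ht ht', ?_⟩
    have : t * t' * (r + r') = t' * (t * r) + t * (t' * r') := by ring
    rw [this]
    exact dvd_add (h.mul_left _) (h'.mul_left _)
  smul_mem' := by
    rintro c r ⟨t, ht, h⟩
    refine ⟨t, ht, ?_⟩
    have : t * (c • r) = c * (t * r) := by simp only [smul_eq_mul]; ring
    rw [this]
    exact h.mul_left _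

variable {p : Ideal R} [p.IsPrime] {x y : R}

lemma mem_localPow_of_mul_mem (hy : y ∉ p) {i : ℕ} {r : R} (h : y * r ∈ localPow p x i) :
    r ∈ localPow p x i := by
  obtain ⟨t, ht, h⟩ := h
  exact ⟨t * y, fun hm => (IsPrime.mem_or_mem ‹_› hm).elim ht hy, by rwa [mul_assoc]⟩

lemma localPow_antitone {i j : ℕ} (hij : i ≤ j) : localPow p x j ≤ localPow p x i :=
  fun _ ⟨t, ht, h⟩ => ⟨t, ht, (pow_dvd_pow x hij).trans h⟩

lemma pow_mem_localPow (i : ℕ) : x ^ i ∈ localPow p x i :=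
  ⟨1, p.one_notMem, by simp⟩

/-- Since `y` is a nonzerodivisor modulo `localPow p x i`, Nakayama's lemma keeps the chain of the
`localPow p x i` strict modulo `y`. -/
lemma le_colength_localPow_sup [IsDomain R] [IsNoetherianRing R] [IsLocalRing R]
    (hx : x ≠ 0) (hxp : x ∈ p) (hy : y ∉ p) (hym : y ∈ IsLocalRing.maximalIdeal R) (k : ℕ) :
    (k : ℕ∞) ≤ (localPow p x k ⊔ span {y}).colength := by
  induction k with
  | zero => simp
  | succ k ih =>
    have hlt : localPow p x (k + 1) ⊔ span {y} < localPow p x k ⊔ span {y} := by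
      refine lt_of_le_of_ne (sup_le_sup_right (localPow_antitone k.le_succ) _) fun heq => ?_
      have hle : localPow p x k ≤ localPow p x (k + 1) := by
        refine Submodule.le_of_le_smul_of_le_jacobson_bot (I := span {y})
          (IsNoetherian.noetherian _) ?_ ?_
        · rw [span_singleton_le_iff_mem]
          exact IsLocalRing.maximalIdeal_le_jacobson _ hym
        · intro q hq
          have hq2 : q ∈ localPow p x (k + 1) ⊔ span {y} := heq ▸ mem_sup_left hq
          obtain ⟨q', hq', z, hz, rfl⟩ := Submodule.mem_sup.1 hq2
          obtain ⟨c, rfl⟩ := mem_span_singleton'.1 hz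
          refine Submodule.add_mem_sup hq' ?_
          rw [mul_comm]
          refine Submodule.smul_mem_smul (mem_span_singleton_self y)
            (mem_localPow_of_mul_mem hy ?_)
          have := (localPow p x k).sub_mem hq (localPow_antitone k.le_succ hq')
          rwa [add_sub_cancel_left, mul_comm] at this
      obtain ⟨t, ht, c, hc⟩ := hle (pow_mem_localPow k)
      refine ht ?_
      have : t = x * c := mul_right_cancel₀ (pow_ne_zero k hx) (by rw [hc]; ring)
      rw [this]
      exact p.mul_mem_right _ hxp
    calc ((k + 1 : ℕ) : ℕ∞) = k + 1 := by push_cast; rfl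
      _ ≤ _ := by gcongr
      _ ≤ _ := colength_add_one_le hlt

/-- The multiplicity bound: lengths modulo `(x ^ k, y ^ k)` grow at least quadratically. -/
lemma sq_le_colength_span_pow [IsDomain R] [IsNoetherianRing R] [IsLocalRing R]
    (hx : x ≠ 0) (hxp : x ∈ p) (hy : y ∉ p) (hym : y ∈ IsLocalRing.maximalIdeal R) (k : ℕ) :
    (k * k : ℕ∞) ≤ (span {x ^ k, y ^ k}).colength := by
  have key (j : ℕ) : (j * k : ℕ∞) ≤ (localPow p x k ⊔ span {y ^ j}).colength := by
    induction j with
    | zero => simp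
    | succ j ih =>
      rw [colength_eq_add (J := localPow p x k ⊔ span {y ^ (j + 1)})
        (K := localPow p x k ⊔ span {y}) (a := y ^ j)]
      · have h1 : localPow p x k ⊔ span {y ^ (j + 1)} ⊔ span {y ^ j} ≤
            localPow p x k ⊔ span {y ^ j} := by
          refine sup_le (sup_le_sup_left ?_ _) le_sup_right
          exact span_singleton_le_span_singleton.2 (pow_dvd_pow y j.le_succ)
        calc (((j + 1 : ℕ) : ℕ∞) * k) = k + j * k := by push_cast; ring
          _ ≤ _ := add_le_add (le_colength_localPow_sup hx hxp hy hym k)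
                (ih.trans (colength_anti h1))
      · intro r
        have hyj : y ^ j ∉ p := fun h => hy (IsPrime.mem_of_pow_mem ‹_› _ h)
        constructor
        · intro hr
          obtain ⟨q, hq, z, hz, rfl⟩ := Submodule.mem_sup.1 hr
          obtain ⟨c, rfl⟩ := mem_span_singleton'.1 hz
          rw [mul_add]
          refine Submodule.add_mem_sup (mul_mem_left _ _ hq) (mem_span_singleton'.2 ⟨c, ?_⟩)
          ring
        · intro hr
          obtain ⟨q, hq, z, hz, hqz⟩ := Submodule.mem_sup.1 hr
          obtain ⟨c, rfl⟩ := mem_span_singleton'.1 hz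
          have : y ^ j * (r - c * y) = q := by linear_combination -hqz
          have h2 : r - c * y ∈ localPow p x k := mem_localPow_of_mul_mem hyj (this ▸ hq)
          rw [← sub_add_cancel r (c * y)]
          exact Submodule.add_mem_sup h2 (mem_span_singleton'.2 ⟨c, rfl⟩)
  refine (key k).trans (colength_anti ?_)
  rw [span_le]
  rintro _ (rfl | rfl)
  · exact mem_sup_left (pow_mem_localPow k)
  · exact mem_sup_right (subset_span rfl)

end LowerBound

end Ideal

/-! ### Relations between powers of a system of parameters -/

section Relation

variable {S A : Type*} [CommRing S] [CommRing A]

/-- Expanding `1 = (x * a + y * b) ^ (2 * k)` gives `1 = x ^ k * α + y ^ k * β` with `α` and `β`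
homogeneous of degree `2 * k` in `a` and `b`, so that `x ^ (2 * N * k)` and `y ^ (2 * N * k)` clear
their denominators. -/
lemma pow_mul_pow_mem_span_of_mul_add_mul_eq_one {ρ : S →+* A} (hρ : Function.Injective ρ)
    {x y : S} {a b : A} (hab : ρ x * a + ρ y * b = 1) {N : ℕ}
    (hxa : ρ x ^ N * a ∈ ρ.range) (hya : ρ y ^ N * a ∈ ρ.range)
    (hxb : ρ x ^ N * b ∈ ρ.range) (hyb : ρ y ^ N * b ∈ ρ.range) (k : ℕ) :
    (x ^ k) ^ (2 * N) * (y ^ k) ^ (2 * N) ∈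
      Ideal.span {(x ^ k) ^ (2 * N + 1), (y ^ k) ^ (2 * N + 1)} := by
  have clear {z : S} (ha : ρ z ^ N * a ∈ ρ.range) (hb : ρ z ^ N * b ∈ ρ.range) {i j : ℕ}
      (hij : i + j = 2 * k) : ρ ((z ^ k) ^ (2 * N)) * (a ^ i * b ^ j) ∈ ρ.range := by
    have : ρ ((z ^ k) ^ (2 * N)) * (a ^ i * b ^ j) = (ρ z ^ N * a) ^ i * (ρ z ^ N * b) ^ j := by
      have e : k * (2 * N) = N * i + N * j := by rw [← mul_add, hij]; ring
      rw [← pow_mul, e, map_pow]; ring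
    rw [this]
    exact ρ.range.mul_mem (pow_mem ha i) (pow_mem hb j)
  -- the image of the ideal under the injection `ρ`, as an additive subgroup of `A`
  let I := Ideal.span {(x ^ k) ^ (2 * N + 1), (y ^ k) ^ (2 * N + 1)}
  let T : AddSubgroup A := I.toAddSubgroup.map ρ.toAddMonoidHom
  suffices h : ρ ((x ^ k) ^ (2 * N) * (y ^ k) ^ (2 * N)) ∈ T by
    obtain ⟨c, hc, hc'⟩ := h
    rw [← hρ hc']
    exact hc
  have hone : (1 : A) = (ρ x * a + ρ y * b) ^ (2 * k) := by rw [hab, one_pow]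
  rw [← mul_one (ρ _), hone, add_pow, Finset.mul_sum]
  refine sum_mem fun i hi => ?_
  rw [mul_comm _ ((Nat.choose _ _ : ℕ) : A), mul_left_comm, ← nsmul_eq_mul]
  refine AddSubgroup.nsmul_mem _ ?_ _
  obtain ⟨j, hj⟩ : ∃ j, i + j = 2 * k := ⟨2 * k - i, by have := Finset.mem_range.1 hi; omega⟩
  have hj' : 2 * k - i = j := by omega
  rw [hj']
  rcases le_total k i with hk | hk
  · obtain ⟨d, rfl⟩ := Nat.exists_eq_add_of_le hk
    obtain ⟨c, hc⟩ := clear hya hyb hj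
    refine ⟨c * (x ^ d * y ^ j) * (x ^ k) ^ (2 * N + 1), ?_, ?_⟩
    · exact I.mul_mem_left _ (Ideal.subset_span (by simp))
    · simp only [RingHom.toAddMonoidHom_eq_coe, AddMonoidHom.coe_coe]
      rw [map_mul, map_mul, hc]
      simp only [map_mul, map_pow]
      ring
  · obtain ⟨d, rfl⟩ : ∃ d, j = k + d := ⟨j - k, by omega⟩
    obtain ⟨c, hc⟩ := clear hxa hxb hj
    refine ⟨c * (x ^ i * y ^ d) * (y ^ k) ^ (2 * N + 1), ?_, ?_⟩
    · exact I.mul_mem_left _ (Ideal.subset_span (by simp))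
    · simp only [RingHom.toAddMonoidHom_eq_coe, AddMonoidHom.coe_coe]
      rw [map_mul, map_mul, hc]
      simp only [map_mul, map_pow]
      ring

/-- In a two-dimensional Noetherian local domain with system of parameters `x`, `y`, no power
`(x * y) ^ s` can lie in `(x ^ (s + 1), y ^ (s + 1))` uniformly for all pairs `x ^ k`, `y ^ k`:
otherwise the length modulo `(x ^ k, y ^ k)` would be `O(k ^ (2 - ε))` along the powers
of `s + 1`. -/
lemma exists_pow_mul_pow_notMem_span [IsDomain S] [IsNoetherianRing S] [IsLocalRing S] {x y : S}
    {p : Ideal S} [p.IsPrime] (hx : x ≠ 0) (hxp : x ∈ p) (hy : y ∉ p)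
    (hxy : IsLocalRing.maximalIdeal S ∈ (Ideal.span {x, y}).minimalPrimes) (s : ℕ) :
    ∃ k : ℕ, (x ^ k) ^ s * (y ^ k) ^ s ∉ Ideal.span {(x ^ k) ^ (s + 1), (y ^ k) ^ (s + 1)} := by
  by_contra! h
  have hym : y ∈ IsLocalRing.maximalIdeal S := hxy.1.2 (Ideal.subset_span (by simp))
  have hfin : (Ideal.span {x, y}).colength ≠ ⊤ := by
    have := IsLocalRing.quotient_artinian_of_mem_minimalPrimes_of_isLocalRing _ hxy
    have h2 : IsArtinian S (S ⧸ Ideal.span {x, y}) :=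
      isArtinian_of_surjective_algebraMap (R := S ⧸ Ideal.span {x, y}) Ideal.Quotient.mk_surjective
    exact Module.length_ne_top
  obtain ⟨C, hC⟩ := ENat.ne_top_iff_exists.1 hfin
  have up (j : ℕ) : (Ideal.span {x ^ (s + 1) ^ j, y ^ (s + 1) ^ j}).colength ≤
      ((s * (s + 2)) ^ j * C : ℕ) := by
    induction j with
    | zero => simp [hC]
    | succ j ih =>
      have := Ideal.colength_span_pow_le_of_mul_mem (h ((s + 1) ^ j))
      rw [← pow_mul, ← pow_mul, ← pow_succ] at this
      refine this.trans ((mul_le_mul_right ih _).trans ?_)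
      rw [← Nat.cast_mul]
      exact Nat.cast_le.2 (by rw [pow_succ]; apply le_of_eq; ring)
  have main (j : ℕ) : ((s + 1) ^ 2) ^ j ≤ (s * (s + 2)) ^ j * C := by
    have := (Ideal.sq_le_colength_span_pow hx hxp hy hym ((s + 1) ^ j)).trans (up j)
    rw [← Nat.cast_mul, Nat.cast_le] at this
    refine le_trans (le_of_eq ?_) this
    rw [← pow_mul, ← pow_add]; congr 1; ring
  rcases Nat.eq_zero_or_pos s with rfl | hs
  · have := main 1
    simp at this
  · -- the ratio `(s + 1) ^ 2 / (s * (s + 2))` exceeds `1`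
    have hpos : (0 : ℝ) < s * (s + 2) := by positivity
    have hr : 1 < ((s : ℝ) + 1) ^ 2 / (s * (s + 2)) := by
      rw [one_lt_div hpos]; nlinarith
    obtain ⟨j, hj⟩ := pow_unbounded_of_one_lt (C : ℝ) hr
    rw [div_pow, lt_div_iff₀ (by positivity)] at hj
    have := main j
    have h3 : (((s : ℝ) + 1) ^ 2) ^ j ≤ (s * (s + 2)) ^ j * C := by exact_mod_cast this
    linarith [mul_comm (C : ℝ) ((s * (s + 2) : ℝ) ^ j)]

end Relation

/-! ### The punctured spectrum of a two-dimensional local domain -/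

namespace AlgebraicGeometry

open CategoryTheory

/-- The property that all open subsets are affine passes to rings `S` over `R` whose spectrum has
the topology induced from `Spec R`, since `Spec S ⟶ Spec R` is an affine morphism. -/
lemma isAffineOpen_of_isInducing_comap {R S : CommRingCat.{u}} (f : R ⟶ S)
    (hf : Topology.IsInducing (PrimeSpectrum.comap f.hom))
    (h : ∀ U : (Spec R).Opens, IsAffineOpen U) (V : (Spec S).Opens) : IsAffineOpen V := by
  obtain ⟨W, hW, hWV⟩ := hf.isOpen_iff.1 V.isOpen
  have : V = Spec.map f ⁻¹ᵁ (⟨W, hW⟩ : (Spec R).Opens) := TopologicalSpace.Opens.ext hWV.symm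
  rw [this]
  exact (h _).preimage _

lemma Spec_basicOpen_algebraMap {R : CommRingCat.{u}} (U : (Spec R).Opens) (r : R) :
    (Spec R).basicOpen (algebraMap R Γ(Spec R, U) r) = U ⊓ PrimeSpectrum.basicOpen r := by
  rw [IsAffineOpen.algebraMap_Spec_obj, CommRingCat.comp_apply, Scheme.basicOpen_res]
  congr 1
  exact basicOpen_eq_of_affine r

lemma map_algebraMap_Spec {R : CommRingCat.{u}} {U V : (Spec R).Opens} (i : V ⟶ U) (r : R) :
    (Spec R).presheaf.map i.op (algebraMap R Γ(Spec R, U) r) = algebraMap R Γ(Spec R, V) r := by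
  simp only [IsAffineOpen.algebraMap_Spec_obj, CommRingCat.comp_apply]
  rw [← CommRingCat.comp_apply, ← CommRingCat.comp_apply, ← CommRingCat.comp_apply,
    ← Functor.map_comp]
  rfl

lemma algebraMap_Spec_injective {R : CommRingCat.{u}} [IsDomain R] (U : (Spec R).Opens)
    [Nonempty U] : Function.Injective (algebraMap R Γ(Spec R, U)) := by
  rw [IsAffineOpen.algebraMap_Spec_obj]
  exact (map_injective_of_isIntegral (Spec R) _).comp
    (ConcreteCategory.bijective_of_isIso (Scheme.ΓSpecIso R).inv).injective

/-- Over a domain, a section on `U ⊇ D(x)` comes from the ring after multiplication by a power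
of `x`. -/
lemma exists_pow_mul_mem_range_algebraMap_Spec {R : CommRingCat.{u}} [IsDomain R]
    {U : (Spec R).Opens} {x : R} (hx : x ≠ 0)
    (hxU : PrimeSpectrum.basicOpen x ≤ U) (a : Γ(Spec R, U)) :
    ∃ n : ℕ, ∀ m ≥ n, algebraMap R Γ(Spec R, U) x ^ m * a ∈ (algebraMap R Γ(Spec R, U)).range := by
  let V : (Spec R).Opens := PrimeSpectrum.basicOpen x
  let i : V ⟶ U := homOfLE hxU
  obtain ⟨n, c, hc⟩ := IsLocalization.Away.surj (S := Γ(Spec R, V)) x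
    ((Spec R).presheaf.map i.op a)
  have hV : Nonempty V :=
    ⟨⟨(⟨⊥, Ideal.isPrime_bot⟩ : PrimeSpectrum R), fun hm => hx (by simpa using hm)⟩⟩
  have key : algebraMap R Γ(Spec R, U) x ^ n * a = algebraMap R Γ(Spec R, U) c := by
    apply map_injective_of_isIntegral (Spec R) i
    rw [map_mul, map_pow, map_algebraMap_Spec, map_algebraMap_Spec, ← hc, mul_comm]
  refine ⟨n, fun m hm => ?_⟩
  obtain ⟨d, rfl⟩ := Nat.exists_eq_add_of_le hm
  exact ⟨x ^ d * c, by rw [map_mul, map_pow, ← key]; ring⟩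

/-- The punctured spectrum of a two-dimensional Noetherian local domain is not affine. -/
lemma not_forall_isAffineOpen_of_ringKrullDim_eq_two {S : CommRingCat.{u}} [IsDomain S]
    [IsNoetherianRing S] [IsLocalRing S] (hS : ringKrullDim S = 2) :
    ¬ ∀ U : (Spec S).Opens, IsAffineOpen U := by
  classical
  intro h
  let m := IsLocalRing.maximalIdeal S
  have hm : m.height = 2 := by
    have := IsLocalRing.maximalIdeal_height_eq_ringKrullDim (R := S)
    rw [hS] at this
    exact WithBot.coe_injective this
  obtain ⟨s, hs, hcard⟩ := m.exists_finset_card_eq_height_of_isNoetherianRing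
  rw [hm] at hcard
  obtain ⟨x, y, -, rfl⟩ := Finset.card_eq_two.1 (by exact_mod_cast hcard : s.card = 2)
  have hxy : m ∈ (Ideal.span {x, y}).minimalPrimes := by simpa using hs
  -- by Krull's principal ideal theorem, `m` is not minimal over a principal ideal
  have hnot (z : S) : m ∉ (Ideal.span {z}).minimalPrimes := fun hz => by
    have := Ideal.height_le_one_of_isPrincipal_of_mem_minimalPrimes _ _ hz
    rw [hm] at this
    exact absurd this (by decide)
  have hxm : x ∈ m := hxy.1.2 (Ideal.subset_span (by simp))
  have hym : y ∈ m := hxy.1.2 (Ideal.subset_span (by simp))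
  have hx : x ≠ 0 := by
    rintro rfl
    refine hnot y ?_
    rwa [Ideal.span_insert_zero] at hxy
  have hy : y ≠ 0 := by
    rintro rfl
    refine hnot x ?_
    rwa [Ideal.span_pair_comm, Ideal.span_insert_zero] at hxy
  obtain ⟨p, hp, hpm⟩ := Ideal.exists_minimalPrimes_le
    (show Ideal.span {x} ≤ m by rwa [Ideal.span_singleton_le_iff_mem])
  have hpp : p.IsPrime := hp.isPrime
  have hxp : x ∈ p := hp.1.2 (Ideal.mem_span_singleton_self x)
  have hyp : y ∉ p := fun hyp => by
    have : m ≤ p := hxy.2 ⟨hpp, by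
      rw [Ideal.span_le]; rintro _ (rfl | rfl) <;> assumption⟩ hpm
    exact hnot x (le_antisymm hpm this ▸ hp)
  let U : (Spec S).Opens := PrimeSpectrum.basicOpen x ⊔ PrimeSpectrum.basicOpen y
  have hUne : Nonempty U :=
    ⟨⟨(⟨⊥, Ideal.isPrime_bot⟩ : PrimeSpectrum S), Or.inl fun hm => hx (by simpa using hm)⟩⟩
  let ρ := algebraMap S Γ(Spec S, U)
  have hspan : Ideal.span {ρ x, ρ y} = ⊤ := by
    rw [← (h U).self_le_iSup_basicOpen_iff]
    refine sup_le ?_ ?_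
    · refine le_trans (le_of_eq ?_) (le_iSup _ ⟨ρ x, by simp⟩)
      rw [Spec_basicOpen_algebraMap]
      exact (inf_eq_right.2 le_sup_left).symm
    · refine le_trans (le_of_eq ?_) (le_iSup _ ⟨ρ y, by simp⟩)
      rw [Spec_basicOpen_algebraMap]
      exact (inf_eq_right.2 le_sup_right).symm
  obtain ⟨a, b, hab⟩ := Ideal.mem_span_pair.1 ((Ideal.eq_top_iff_one _).1 hspan)
  obtain ⟨n₁, h₁⟩ := exists_pow_mul_mem_range_algebraMap_Spec (U := U) hx le_sup_left a
  obtain ⟨n₂, h₂⟩ := exists_pow_mul_mem_range_algebraMap_Spec (U := U) hy le_sup_right a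
  obtain ⟨n₃, h₃⟩ := exists_pow_mul_mem_range_algebraMap_Spec (U := U) hx le_sup_left b
  obtain ⟨n₄, h₄⟩ := exists_pow_mul_mem_range_algebraMap_Spec (U := U) hy le_sup_right b
  let N := n₁ + n₂ + n₃ + n₄
  obtain ⟨k, hk⟩ := exists_pow_mul_pow_notMem_span hx hxp hyp hxy (2 * N)
  refine hk (pow_mul_pow_mem_span_of_mul_add_mul_eq_one (ρ := ρ) (algebraMap_Spec_injective U)
    (a := a) (b := b) (by rw [← hab]; ring) (h₁ N ?_) (h₂ N ?_) (h₃ N ?_) (h₄ N ?_) k) <;>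
  · simp only [N]; omega

end AlgebraicGeometry

/-! ### Chains of primes and closed subsets in low dimension -/

section OneDimensional

variable {R : Type u} [CommRing R] [IsNoetherianRing R]

/-- In a Noetherian ring of dimension at least two, some localized quotient is a two-dimensional
domain: above the bottom `q` of a chain of three primes there is a prime of height two
in `R ⧸ q`. -/
lemma exists_isPrime_height_quotient_eq_two (h : ¬ ringKrullDim R ≤ 1) :
    ∃ q : Ideal R, q.IsPrime ∧ ∃ P : Ideal (R ⧸ q), P.IsPrime ∧ P.height = 2 := by
  rw [ringKrullDim, Order.krullDim_le_one_iff] at h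
  push Not at h
  obtain ⟨x, hmin, hmax⟩ := h
  obtain ⟨q, hq⟩ := not_isMin_iff.1 hmin
  obtain ⟨r, hr⟩ := not_isMax_iff.1 hmax
  refine ⟨q.asIdeal, q.isPrime, ?_⟩
  have lift (z : PrimeSpectrum R) (hz : q ≤ z) :
      ∃ z' : PrimeSpectrum (R ⧸ q.asIdeal),
        z'.asIdeal.comap (Ideal.Quotient.mk q.asIdeal) = z.asIdeal :=
    ⟨⟨z.asIdeal.map _, Ideal.isPrime_map_quotientMk_of_isPrime hz⟩, Ideal.comap_map_mk hz⟩
  obtain ⟨q', hq'⟩ := lift q le_rfl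
  obtain ⟨x', hx'⟩ := lift x hq.le
  obtain ⟨r', hr'⟩ := lift r (hq.trans hr).le
  have mono {z w : PrimeSpectrum R} {z' w' : PrimeSpectrum (R ⧸ q.asIdeal)}
      (hz : z'.asIdeal.comap (Ideal.Quotient.mk q.asIdeal) = z.asIdeal)
      (hw : w'.asIdeal.comap (Ideal.Quotient.mk q.asIdeal) = w.asIdeal) (hzw : z < w) :
      z' < w' := by
    have hlt : z.asIdeal < w.asIdeal := hzw
    rw [← hz, ← hw] at hlt
    refine lt_of_le_not_ge ?_ fun hle => hlt.not_ge (Ideal.comap_mono hle)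
    exact (Ideal.comap_le_comap_iff_of_surjective _ Ideal.Quotient.mk_surjective _ _).1 hlt.le
  have h1 : 1 < Order.height r' :=
    Order.one_lt_height_iff.2 ⟨x', q', mono hq' hx' hq, mono hx' hr' hr⟩
  have h2 : (2 : ℕ∞) ≤ Order.height r' := by
    rw [← one_add_one_eq_two]; exact Order.add_one_le_of_lt h1
  rcases h2.eq_or_lt with h2 | h2
  · exact ⟨r'.asIdeal, r'.isPrime, by rw [PrimeSpectrum.height_eq_orderHeight, ← h2]⟩
  · have hfin : Order.height r' < ⊤ := by
      rw [← PrimeSpectrum.height_eq_orderHeight]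
      exact (Ideal.height_ne_top r'.isPrime.ne_top).lt_top
    obtain ⟨P, -, hP⟩ := (Order.coe_lt_height_iff (n := 2) hfin).1 h2
    exact ⟨P.asIdeal, P.isPrime, by rw [PrimeSpectrum.height_eq_orderHeight, hP]; rfl⟩

/-- In dimension at most one, `V(I)` is a hypersurface `V(f)` up to finitely many closed
points. -/
lemma exists_finite_isMaximal_of_ringKrullDim_le_one (h : ringKrullDim R ≤ 1) (I : Ideal R) :
    ∃ f ∈ I, ∃ T : Set (Ideal R), T.Finite ∧ (∀ m ∈ T, m.IsMaximal ∧ ¬ I ≤ m) ∧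
      ∀ p : Ideal R, p.IsPrime → f ∈ p → ¬ I ≤ p → p ∈ T := by
  rw [ringKrullDim, Order.krullDim_le_one_iff] at h
  have hfin := (minimalPrimes.finite_of_isNoetherianRing R).subset
    (Set.sep_subset (minimalPrimes R) fun q => ¬ I ≤ q)
  obtain ⟨f, hfI, hf⟩ := Set.not_subset.1
    (fun hsub => by
      obtain ⟨q, hq, hIq⟩ := (Ideal.subset_union_prime_finite hfin (f := id) 0 0
        (fun q hq _ _ => hq.1.1.1)).1 hsub
      exact hq.2 hIq :
      ¬ (I : Set R) ⊆ ⋃ q ∈ {q ∈ minimalPrimes R | ¬ I ≤ q}, ((id q : Ideal R) : Set R))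
  -- by the choice of `f`, a minimal prime containing `f` contains `I`
  have hf' (q : PrimeSpectrum R) (hq : IsMin q) (hfq : f ∈ q.asIdeal) : I ≤ q.asIdeal := by
    by_contra hI
    exact hf (Set.mem_biUnion (x := q.asIdeal) ⟨PrimeSpectrum.isMin_iff.1 hq, hI⟩ hfq)
  refine ⟨f, hfI, {m ∈ (Ideal.span {f}).minimalPrimes | ¬ I ≤ m},
    (Ideal.finite_minimalPrimes_of_isNoetherianRing R _).subset (Set.sep_subset _ _), ?_, ?_⟩
  · rintro m ⟨hm, hIm⟩
    refine ⟨?_, hIm⟩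
    have hfm : f ∈ m := hm.1.2 (Ideal.mem_span_singleton_self f)
    rcases h ⟨m, hm.isPrime⟩ with hmin | hmax
    · exact absurd (hf' _ hmin hfm) hIm
    · exact PrimeSpectrum.isMax_iff.1 hmax
  · intro p hp hfp hIp
    obtain ⟨q, hq, hqp⟩ := Ideal.exists_minimalPrimes_le
      (show Ideal.span {f} ≤ p by rwa [Ideal.span_singleton_le_iff_mem])
    have hqI : ¬ I ≤ q := fun hI => hIp (hI.trans hqp)
    rcases h ⟨q, hq.isPrime⟩ with hmin | hmax
    · exact absurd (hf' _ hmin (hq.1.2 (Ideal.mem_span_singleton_self f))) hqI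
    · have := (PrimeSpectrum.isMax_iff.1 hmax).eq_of_le hp.ne_top hqp
      exact ⟨this ▸ hq, hIp⟩

end OneDimensional

/-! ### Affineness of open subsets -/

namespace AlgebraicGeometry

open CategoryTheory

/-- The closed points of `V(f)` outside `V(I)` are separated from `V(I)` by `b = 1 - a` with
`a ∈ I`, and `D(a)`, `D(b)` meet `U` in basic open sets. -/
lemma isAffineOpen_of_ringKrullDim_le_one {R : CommRingCat.{u}} [IsNoetherianRing R]
    (h : ringKrullDim R ≤ 1) (U : (Spec R).Opens) : IsAffineOpen U := by
  obtain ⟨I, hI⟩ := (PrimeSpectrum.isClosed_iff_zeroLocus_ideal _).1 U.isOpen.isClosed_compl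
  have hU (p : PrimeSpectrum R) : p ∈ U ↔ ¬ I ≤ p.asIdeal := by
    have := Set.ext_iff.1 hI p
    change p ∉ U ↔ I ≤ p.asIdeal at this
    exact (not_iff_comm.1 this).symm
  obtain ⟨f, hfI, T, hT, hTmax, hTmem⟩ := exists_finite_isMaximal_of_ringKrullDim_le_one h I
  have htop : I ⊔ ⨅ m ∈ hT.toFinset, m = ⊤ := by
    refine Ideal.sup_iInf_eq_top (J := id) fun m hm => ?_
    obtain ⟨hmax, hle⟩ := hTmax m (hT.mem_toFinset.1 hm)
    rw [sup_comm]
    exact hmax.1.2 _ (left_lt_sup.2 hle)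
  obtain ⟨a, ha, b, hb, hab⟩ := Submodule.mem_sup.1 ((Ideal.eq_top_iff_one _).1 htop)
  let ρ := algebraMap R Γ(Spec R, U)
  refine isAffineOpen_of_isAffineOpen_basicOpen U {ρ a, ρ b} ?_ ?_
  · rw [Ideal.eq_top_iff_one, Ideal.mem_span_pair]
    exact ⟨1, 1, by rw [one_mul, one_mul, ← map_add, hab, map_one]⟩
  · rintro _ (rfl | rfl)
    · have hUa : U ⊓ PrimeSpectrum.basicOpen a = PrimeSpectrum.basicOpen a :=
        inf_eq_right.2 fun p hp => (hU p).2 fun hle => hp (hle ha)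
      exact (Spec_basicOpen_algebraMap U a).trans hUa ▸ IsAffineOpen.Spec_basicOpen a
    · -- `b` vanishes at the points of `T`, so that `U ∩ D(b) = D(b * f)`
      have hmem (p : PrimeSpectrum R) :
          (p ∈ U ∧ b ∉ p.asIdeal) ↔ b * f ∉ p.asIdeal := by
        rw [p.isPrime.mul_mem_iff_mem_or_mem, not_or, and_comm, hU]
        refine and_congr_right fun hbp => ⟨fun hIp hfp => hbp ?_, fun hfp hIp => hfp (hIp hfI)⟩
        have := hTmem p.asIdeal p.isPrime hfp hIp
        simp only [Submodule.mem_iInf] at hb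
        exact hb _ (hT.mem_toFinset.2 this)
      have hUb : U ⊓ PrimeSpectrum.basicOpen b = PrimeSpectrum.basicOpen (b * f) :=
        TopologicalSpace.Opens.ext (Set.ext hmem)
      exact (Spec_basicOpen_algebraMap U b).trans hUb ▸ IsAffineOpen.Spec_basicOpen (b * f)

lemma ringKrullDim_le_one_of_forall_isAffineOpen {R : Type u} [CommRing R] [IsNoetherianRing R]
    (h : ∀ U : (Spec (CommRingCat.of R)).Opens, IsAffineOpen U) : ringKrullDim R ≤ 1 := by
  by_contra hR
  obtain ⟨q, hq, P, hP, hP2⟩ := exists_isPrime_height_quotient_eq_two hR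
  have hdim : ringKrullDim (Localization.AtPrime P) = 2 := by
    rw [IsLocalization.AtPrime.ringKrullDim_eq_height P, hP2]; rfl
  have h1 := isAffineOpen_of_isInducing_comap (CommRingCat.ofHom (Ideal.Quotient.mk q))
    (PrimeSpectrum.isClosedEmbedding_comap_of_surjective _ _
      Ideal.Quotient.mk_surjective).isInducing h
  have h2 := isAffineOpen_of_isInducing_comap
    (CommRingCat.ofHom (algebraMap (R ⧸ q) (Localization.AtPrime P)))
    (PrimeSpectrum.localization_comap_isInducing _ P.primeCompl) h1
  have : IsDomain (CommRingCat.of (Localization.AtPrime P)) :=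
    inferInstanceAs (IsDomain (Localization.AtPrime P))
  have : IsNoetherianRing (CommRingCat.of (Localization.AtPrime P)) :=
    inferInstanceAs (IsNoetherianRing (Localization.AtPrime P))
  have : IsLocalRing (CommRingCat.of (Localization.AtPrime P)) :=
    inferInstanceAs (IsLocalRing (Localization.AtPrime P))
  exact not_forall_isAffineOpen_of_ringKrullDim_eq_two
    (S := CommRingCat.of (Localization.AtPrime P)) hdim h2

end AlgebraicGeometry

theorem mainTheorem1 (R : Type u) [CommRing R] [IsNoetherianRing R] :
    ((∀ U : (AlgebraicGeometry.Spec (CommRingCat.of R)).Opens,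
        AlgebraicGeometry.IsAffineOpen U) → ringKrullDim R ≤ 1) ∧
      (ringKrullDim R ≤ 1 → (ringKrullDim R = 1 → IsReduced R) →
        ∀ U : (AlgebraicGeometry.Spec (CommRingCat.of R)).Opens,
          AlgebraicGeometry.IsAffineOpen U) := by
  have : IsNoetherianRing (CommRingCat.of R) := inferInstanceAs (IsNoetherianRing R)
  exact ⟨AlgebraicGeometry.ringKrullDim_le_one_of_forall_isAffineOpen,
    fun h _ =>
      AlgebraicGeometry.isAffineOpen_of_ringKrullDim_le_one (R := CommRingCat.of R) h⟩
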